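/- Let $m\ge 3$. A ranking of the alternatives $[m]=\{1,\dots,m\}$ is a permutation $x\in\mathbb S_m$ with $x(\text{rank})=\text{name}$, so that $x^{-1}(j)$ is the rank of the alternative $j$. A subgroup $H\subseteq\mathbb S_m$ is called fixing if there is a partition of the set of the $m$ ranks into two or more nonempty parts such that $H$ consists of all permutations mapping each part to itself. The coset of a ranking $x$ is $\{x\circ h : h\in H\}$ (the permutation $h$ of the ranks is applied first), $\mathbb S_m/H$ is the set of these cosets, and an $H$-social aggregator for $n$ voters is a function $f:\mathbb S_m^n\to\mathbb S_m/H$. For $j\in[m]$ the $j$-profile of a coset $K$ is the multiset $K^{-1}(j)=\{y^{-1}(j) : y\in K\}$; let $Q_j$ be the set of the $j$-profiles of all cosets. For every rank $r\in[m]$ and every alternative $j\in[m]$ let an arbitrary strict total order $<_{r,j}$ on $Q_j$ be given (the preference over $j$-profiles of a voter who ranks $j$ at place $r$). The total manipulation power of $f$ is $$M(f)=\sum_{i=1}^n\sum_{j=1}^m \Pr_{x\in\mathbb S_m^n,\;y\in\mathbb S_m}\Bigl[f(x)^{-1}(j)\;<_{x_i^{-1}(j),\,j}\; f(x^{-i},y)^{-1}(j)\Bigr],$$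 where $x$ and $y$ are uniform and independent, and $(x^{-i},y)$ is $x$ with the $i$-th vote replaced by $y$. Then there are absolute constants $C$ and $k$ such that the following holds for all $m\ge 3$, every fixing subgroup $H\subseteq\mathbb S_m$, all orders $<_{r,j}$ as above, every $n$, every $H$-social aggregator $f:\mathbb S_m^n\to\mathbb S_m/H$ and every real $\varepsilon$: if $M(f)\le\varepsilon$, then there is an $H$-social aggregator $g:\mathbb S_m^n\to\mathbb S_m/H$ with $$\Pr_{x\in\mathbb S_m^n}[f(x)\ne g(x)]\le C\,m^k\,\varepsilon$$ ($x$ uniform) such that $g$ is either a constant function or dictatorial of the following form: there are a voter $i$ and a constant permutation $y$ of the ranks such that, for all $x$, $g(x)$ is the coset of $x_i\circ y$ ($y$ is applied first). -/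

import Mathlib

open scoped BigOperators

namespace SocialChoice

/-- A ranking of `m` alternatives is a permutation `x` with `x rank = name`; accordingly
`x⁻¹ j` is the rank of the alternative `j`. -/
abbrev Ranking (m : ℕ) : Type := Equiv.Perm (Fin m)

/-- `H` is a fixing subgroup: it consists of all permutations respecting each part of a
given partition of the `m` ranks into two or more parts. -/
def IsFixing {m : ℕ} (H : Subgroup (Ranking m)) : Prop :=
  ∃ P : Finpartition (Finset.univ : Finset (Fin m)),
    2 ≤ P.parts.card ∧
      ∀ σ : Ranking m, σ ∈ H ↔ ∀ B ∈ P.parts, ∀ a ∈ B, σ a ∈ B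

/-- The outcomes of an `H`-social aggregator. Elements of `H` permute ranks, so they act before
a ranking `x` does, and the coset of `x` is `{x ∘ h | h ∈ H}`, where `x ∘ h` means that `h` is
applied first; this is the set which is written `Hx` (a right coset) when products of
permutations are read from left to right. -/
abbrev Outcome {m : ℕ} (H : Subgroup (Ranking m)) : Type := Ranking m ⧸ H

/-- An `H`-social aggregator for `n` voters. -/
abbrev Aggregator (n : ℕ) {m : ℕ} (H : Subgroup (Ranking m)) : Type :=
  (Fin n → Ranking m) → Outcome H

open Classical in
/-- The `j`-profile of a coset `K`: the multiset `{y⁻¹ j | y ∈ K}`. -/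
noncomputable def profile {m : ℕ} (H : Subgroup (Ranking m)) (j : Fin m) (K : Outcome H) :
    Multiset (Fin m) :=
  (Finset.univ.filter fun y : Ranking m => (QuotientGroup.mk y : Outcome H) = K).val.map
    fun y => y⁻¹ j

/-- The set `Q_j` of all possible `j`-profiles of a coset of `H`. -/
def Profiles {m : ℕ} (H : Subgroup (Ranking m)) (j : Fin m) : Set (Multiset (Fin m)) :=
  Set.range (profile H j)

/-- The `j`-profile of a coset, as an element of `Q_j`. -/
noncomputable def profileIn {m : ℕ} (H : Subgroup (Ranking m)) (j : Fin m) (K : Outcome H) :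
    Profiles H j :=
  ⟨profile H j K, Set.mem_range_self K⟩

/-- A preference system: for every rank `r` and every alternative `j` a full (total) transitive
strict order `lt r j` on `Q_j`. Here `lt r j S T` says that a voter who ranks the alternative `j`
at place `r` strictly prefers the `j`-profile `T` to the `j`-profile `S`. -/
structure Preferences {m : ℕ} (H : Subgroup (Ranking m)) where
  lt : Fin m → (j : Fin m) → Profiles H j → Profiles H j → Prop
  strictTotal : ∀ r j, IsStrictTotalOrder (Profiles H j) (lt r j)

open Classical in
/-- The manipulation power of the voter `i`. The true profile `x = (x⁻ⁱ, x i)` and the false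
report `y` are uniform and independent; `Function.update x i y` is `(x⁻ⁱ, y)`. -/
noncomputable def manipulationPower {n m : ℕ} {H : Subgroup (Ranking m)} (p : Preferences H)
    (f : Aggregator n H) (i : Fin n) : ℝ :=
  ∑ j : Fin m, 𝔼 x : Fin n → Ranking m, 𝔼 y : Ranking m,
    if p.lt ((x i)⁻¹ j) j (profileIn H j (f x)) (profileIn H j (f (Function.update x i y)))
    then (1 : ℝ) else 0

/-- The total manipulation power `M(f)`. -/
noncomputable def totalManipulationPower {n m : ℕ} {H : Subgroup (Ranking m)}
    (p : Preferences H) (f : Aggregator n H) : ℝ :=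
  ∑ i : Fin n, manipulationPower p f i

/-- `f` is a constant function. -/
def IsConstant {n m : ℕ} {H : Subgroup (Ranking m)} (f : Aggregator n H) : Prop :=
  ∃ K : Outcome H, ∀ x, f x = K

/-- `f` is dictatorial: for some voter `i` and some constant permutation `y` of the ranks, the
outcome is the coset of the ranking `x i ∘ y` (first permute ranks by `y`, then apply `x i`). -/
def IsDictatorial {n m : ℕ} {H : Subgroup (Ranking m)} (f : Aggregator n H) : Prop :=
  ∃ (i : Fin n) (y : Ranking m), ∀ x, f x = QuotientGroup.mk (x i * y)

open Classical in
/-- The distance of two aggregators: the probability, for a uniform profile of votes, that they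
return different outcomes. -/
noncomputable def distance {n m : ℕ} {H : Subgroup (Ranking m)} (f g : Aggregator n H) : ℝ :=
  𝔼 x : Fin n → Ranking m, if f x ≠ g x then (1 : ℝ) else 0

end SocialChoice

/-! An outcome is determined by the part of the ranks into which it puts each alternative. If a
voter replaces a vote by one with `j` at the same rank, the same order judges both outcomes, so any
change of the part of `j` is a gain in one of the two directions. Small manipulation power therefore
makes the part of `j` nearly a function `g j` of the ranks of `j` alone (`exists_near_ranks`,
`exists_rank_functions`).

All outcomes have the same multiset of parts. Hence exchanging `j` and `k` in some of the votes
preserves the pair of their parts. Comparing two such exchanges, with a third alternative `l`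
supplying a second vector of ranks (this is where `3 ≤ m` enters), shows that for most `r, s` the
multiset of `g k r` and `g k s` survives an exchange of the coordinates in any fixed set `S`
(`defect_le`).

Such a function is nearly a function of one coordinate (`exists_near_eval`), because `S` and its
complement cannot both be influential (`flip_mul_flip_compl_le`). An influential coordinate is thus
a dictator. Without one, the function is close to a constant, and a level-one inequality in the
Efron-Stein decomposition improves this closeness to the order of the defect (`exists_near_const`).

Finally, swapping two alternatives in one vote shows that nonconstant behaviour forces a common
dictator and a common rule for all alternatives (`exists_constant_or_dictatorial`). -/

namespace SocialChoice

/-! ### Uniform probabilities and expectations -/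

section Probability

variable {α β ι Ω : Type*} [Fintype α] [Fintype β]

open Classical in
/-- The indicator of a proposition, as a real number. -/
noncomputable def ind (p : Prop) : ℝ := if p then 1 else 0

theorem ind_true {p : Prop} (h : p) : ind p = 1 := if_pos h

theorem ind_false {p : Prop} (h : ¬p) : ind p = 0 := if_neg h

theorem ind_nonneg (p : Prop) : 0 ≤ ind p := by
  by_cases h : p <;> simp [ind, h]

theorem ind_le_one (p : Prop) : ind p ≤ 1 := by
  by_cases h : p <;> simp [ind, h]

theorem ind_mono {p q : Prop} (h : p → q) : ind p ≤ ind q := by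
  by_cases hp : p
  · rw [ind_true hp, ind_true (h hp)]
  · rw [ind_false hp]; exact ind_nonneg q

theorem ind_or_le (p q : Prop) : ind (p ∨ q) ≤ ind p + ind q := by
  by_cases hp : p <;> by_cases hq : q <;> simp [ind, hp, hq]

theorem ind_and (p q : Prop) : ind (p ∧ q) = ind p * ind q := by
  by_cases hp : p <;> by_cases hq : q <;> simp [ind, hp, hq]

/-- The probability of an event under the uniform distribution. -/
noncomputable def pr (p : α → Prop) : ℝ := 𝔼 x, ind (p x)

theorem expect_mono {f g : α → ℝ} (h : ∀ x, f x ≤ g x) : 𝔼 x, f x ≤ 𝔼 x, g x :=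
  Finset.expect_le_expect fun x _ => h x

theorem expect_nonneg' {f : α → ℝ} (h : ∀ x, 0 ≤ f x) : 0 ≤ 𝔼 x, f x :=
  Finset.expect_nonneg fun x _ => h x

theorem pr_nonneg (p : α → Prop) : 0 ≤ pr p := expect_nonneg' fun _ => ind_nonneg _

theorem pr_mono {p q : α → Prop} (h : ∀ x, p x → q x) : pr p ≤ pr q :=
  expect_mono fun x => ind_mono (h x)

theorem pr_or_le (p q : α → Prop) : pr (fun x => p x ∨ q x) ≤ pr p + pr q := by
  unfold pr
  rw [← Finset.expect_add_distrib]
  exact expect_mono fun x => ind_or_le _ _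

theorem pr_exists_le {κ : Type*} [Fintype κ] (p : κ → α → Prop) :
    pr (fun x => ∃ k, p k x) ≤ ∑ k, pr (p k) := by
  unfold pr
  rw [← Finset.expect_sum_comm]
  refine expect_mono fun x => ?_
  by_cases h : ∃ k, p k x
  · obtain ⟨k, hk⟩ := h
    rw [ind_true ⟨k, hk⟩, ← ind_true hk]
    exact Finset.single_le_sum (f := fun k => ind (p k x)) (fun k _ => ind_nonneg _)
      (Finset.mem_univ k)
  · rw [ind_false h]
    exact Finset.sum_nonneg fun k _ => ind_nonneg _

theorem exists_not_of_pr_lt_one [Nonempty α] {p : α → Prop} (h : pr p < 1) : ∃ x, ¬p x := by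
  obtain ⟨x, -, hx⟩ := Finset.exists_lt_of_expect_lt Finset.univ_nonempty h
  exact ⟨x, fun hp => by simp [ind, hp] at hx⟩

theorem exists_of_pr_lt {p q : α → Prop} (h : pr p < pr q) : ∃ x, q x ∧ ¬p x := by
  obtain ⟨x, -, hx⟩ := Finset.exists_lt_of_expect_lt_expect h
  refine ⟨x, ?_, fun hp => ?_⟩
  · by_contra hq
    rw [ind_false hq] at hx
    exact absurd hx (not_lt.2 (ind_nonneg _))
  · rw [ind_true hp] at hx
    exact absurd hx (not_lt.2 (ind_le_one _))

theorem expect_comp_equiv (e : α ≃ β) (h : β → ℝ) : 𝔼 x, h (e x) = 𝔼 y, h y :=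
  Fintype.expect_equiv e _ _ fun _ => rfl

theorem pr_comp_equiv (e : α ≃ β) (p : β → Prop) : pr (fun x => p (e x)) = pr p :=
  expect_comp_equiv e fun y => ind (p y)

theorem expect_prod (h : α × β → ℝ) : 𝔼 z, h z = 𝔼 x, 𝔼 y, h (x, y) := by
  rw [← Finset.univ_product_univ, Finset.expect_product]

end Probability

/-! ### Averaging over coordinates and the level-one inequality -/

section Product

variable {ι Ω : Type*} [Fintype ι] [DecidableEq ι] [Fintype Ω]

/-- Exchanging the coordinates in `S` between two points of a power. -/
def exchange (S : Finset ι) : (ι → Ω) × (ι → Ω) ≃ (ι → Ω) × (ι → Ω) where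
  toFun z := (S.piecewise z.2 z.1, S.piecewise z.1 z.2)
  invFun z := (S.piecewise z.2 z.1, S.piecewise z.1 z.2)
  left_inv z := by
    ext i <;> by_cases hi : i ∈ S <;> simp [hi]
  right_inv z := by
    ext i <;> by_cases hi : i ∈ S <;> simp [hi]

theorem expect_exchange (S : Finset ι) (h : (ι → Ω) → (ι → Ω) → ℝ) :
    𝔼 r, 𝔼 s, h (S.piecewise s r) (S.piecewise r s) = 𝔼 r, 𝔼 s, h r s := by
  rw [← expect_prod fun z : (ι → Ω) × (ι → Ω) => h (S.piecewise z.2 z.1) (S.piecewise z.1 z.2),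
    ← expect_prod fun z : (ι → Ω) × (ι → Ω) => h z.1 z.2]
  exact expect_comp_equiv (exchange S) fun z => h z.1 z.2

theorem expect_piecewise [Nonempty Ω] (S : Finset ι) (h : (ι → Ω) → ℝ) :
    𝔼 r, 𝔼 s, h (S.piecewise s r) = 𝔼 r, h r := by
  rw [expect_exchange S fun r _ => h r]
  simp

theorem expect_eval [Nonempty Ω] (i : ι) (h : Ω → ℝ) : 𝔼 s : ι → Ω, h (s i) = 𝔼 a, h a := by
  have := expect_comp_equiv (Equiv.funSplitAt i Ω) fun z => h z.1
  rw [expect_prod] at this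
  simpa using this

theorem expect_update [Nonempty Ω] (i : ι) (h : (ι → Ω) → ℝ) :
    𝔼 r, 𝔼 a, h (Function.update r i a) = 𝔼 r, h r := by
  rw [← expect_piecewise {i} h]
  refine Finset.expect_congr rfl fun r _ => ?_
  simp only [Finset.piecewise_singleton]
  exact (expect_eval i fun a => h (Function.update r i a)).symm

/-- The average of a function on a power over the coordinates in `S`. -/
noncomputable def avg (S : Finset ι) (u : (ι → Ω) → ℝ) (r : ι → Ω) : ℝ :=
  𝔼 s : ι → Ω, u (S.piecewise s r)

/-- The correlation of a function on a power with its average over the coordinates in `S`. -/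
noncomputable def corr (u : (ι → Ω) → ℝ) (S : Finset ι) : ℝ := 𝔼 r, u r * avg S u r

theorem avg_sub (S : Finset ι) (u v : (ι → Ω) → ℝ) : avg S (u - v) = avg S u - avg S v := by
  ext r; simp [avg, Finset.expect_sub_distrib]

theorem avg_avg (S T : Finset ι) (u : (ι → Ω) → ℝ) : avg S (avg T u) = avg (S ∪ T) u := by
  ext r
  unfold avg
  have := expect_exchange T fun s (_ : ι → Ω) => u ((S ∪ T).piecewise s r)
  have h2 : 𝔼 s : ι → Ω, 𝔼 _t : ι → Ω, u ((S ∪ T).piecewise s r) =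
      𝔼 s : ι → Ω, u ((S ∪ T).piecewise s r) := by
    refine Finset.expect_congr rfl fun s _ => ?_
    have : Nonempty (ι → Ω) := ⟨s⟩
    exact Fintype.expect_const _
  rw [← h2, ← this]
  refine Finset.expect_congr rfl fun s _ => Finset.expect_congr rfl fun t _ => congrArg u ?_
  ext i
  by_cases hT : i ∈ T <;> by_cases hS : i ∈ S <;> simp [hT, hS]

theorem avg_empty [Nonempty Ω] (u : (ι → Ω) → ℝ) : avg ∅ u = u := by
  ext r; simp [avg]

theorem expect_mul_avg_comm (S : Finset ι) (u v : (ι → Ω) → ℝ) :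
    𝔼 r, u r * avg S v r = 𝔼 r, avg S u r * v r := by
  have := expect_exchange S fun r s => u r * v (S.piecewise s r)
  unfold avg
  simp only [Finset.mul_expect, Finset.expect_mul]
  rw [← this]
  refine Finset.expect_congr rfl fun s _ => Finset.expect_congr rfl fun t _ => ?_
  congr 2
  ext i
  by_cases hS : i ∈ S <;> simp [hS]

theorem corr_sub (S : Finset ι) (u v : (ι → Ω) → ℝ) :
    corr (u - v) S = corr u S - 2 * 𝔼 r, u r * avg S v r + corr v S := by
  have h : 𝔼 r, v r * avg S u r = 𝔼 r, u r * avg S v r := by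
    rw [expect_mul_avg_comm]
    exact Finset.expect_congr rfl fun r _ => mul_comm _ _
  unfold corr
  rw [avg_sub, two_mul]
  nth_rw 2 [← h]
  rw [← Finset.expect_add_distrib, ← Finset.expect_sub_distrib, ← Finset.expect_add_distrib]
  refine Finset.expect_congr rfl fun r _ => ?_
  simp only [Pi.sub_apply]; ring

theorem corr_avg (S T : Finset ι) (u : (ι → Ω) → ℝ) : corr (avg T u) S = corr u (S ∪ T) := by
  unfold corr
  rw [← expect_mul_avg_comm]
  simp only [avg_avg]
  rw [Finset.union_left_comm, Finset.union_self]

theorem expect_mul_avg_avg (S T : Finset ι) (u : (ι → Ω) → ℝ) :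
    𝔼 r, u r * avg S (avg T u) r = corr u (S ∪ T) := by
  rw [avg_avg]; rfl

theorem corr_sub_avg (S T : Finset ι) (u : (ι → Ω) → ℝ) :
    corr (u - avg T u) S = corr u S - corr u (S ∪ T) := by
  rw [corr_sub, expect_mul_avg_avg, corr_avg]; ring

/-- With `I` the identity, the squared norm of `(I - avg T) (I - avg S) u` equals the right side
minus the left side. -/
theorem corr_add_corr_le [Nonempty Ω] (S T : Finset ι) (u : (ι → Ω) → ℝ) :
    corr u S + corr u T ≤ corr u ∅ + corr u (S ∪ T) := by
  have h : 0 ≤ corr (u - avg S u - avg T (u - avg S u)) ∅ := by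
    refine expect_nonneg' fun r => ?_
    rw [avg_empty]
    exact mul_self_nonneg _
  rw [corr_sub_avg, corr_sub_avg, corr_sub_avg, Finset.empty_union, Finset.empty_union,
    Finset.union_comm T S] at h
  linarith

/-- Pair each `S` with `A \ S` and apply `corr_add_corr_le`. -/
theorem two_mul_sum_corr_le [Nonempty Ω] (A : Finset ι) (u : (ι → Ω) → ℝ) :
    2 * ∑ S ∈ A.powerset, corr u S ≤ 2 ^ A.card * (corr u ∅ + corr u A) := by
  have h : ∑ S ∈ A.powerset, corr u S = ∑ S ∈ A.powerset, corr u (A \ S) := by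
    refine Finset.sum_nbij' (fun S => A \ S) (fun S => A \ S) ?_ ?_ ?_ ?_ ?_ <;> intro S hS <;>
      simp only [Finset.mem_powerset] at hS ⊢
    · exact Finset.sdiff_subset
    · exact Finset.sdiff_subset
    · exact Finset.sdiff_sdiff_eq_self hS
    · exact Finset.sdiff_sdiff_eq_self hS
    · rw [Finset.sdiff_sdiff_eq_self hS]
  rw [two_mul]
  nth_rw 2 [h]
  rw [← Finset.sum_add_distrib]
  refine (Finset.sum_le_card_nsmul _ _ (corr u ∅ + corr u A) fun S hS => ?_).trans ?_
  · have := corr_add_corr_le S (A \ S) u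
    rwa [Finset.union_sdiff_of_subset (Finset.mem_powerset.1 hS)] at this
  · rw [Finset.card_powerset, nsmul_eq_mul]; push_cast; rfl

/-- When a random set of coordinates is averaged out, at most a half of the first level of the
variance and at most a quarter of the higher levels survives on average. -/
theorem four_mul_sum_corr_le [Nonempty Ω] (A : Finset ι) (u : (ι → Ω) → ℝ) :
    4 * ∑ S ∈ A.powerset, corr u S ≤
      2 ^ A.card * (∑ i ∈ A, (corr u (A.erase i) - corr u A) + corr u ∅ + 3 * corr u A) := by
  induction A using Finset.induction_on generalizing u with
  | empty => simp; linarith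
  | insert i A hi ih =>
    -- The function splits into `w`, free of coordinate `i`, and `c`, centred in it. Induction
    -- handles `w`. Sets containing `i` annihilate `c`, which gains a factor of two, so the cruder
    -- `two_mul_sum_corr_le` suffices for `c`.
    set w := avg {i} u
    set c := u - w
    have hw : ∀ S, corr w S = corr u (insert i S) := fun S => by
      rw [corr_avg, Finset.union_comm, Finset.insert_eq]
    have hc : ∀ S, corr c S = corr u S - corr u (insert i S) := fun S => by
      rw [corr_sub_avg, Finset.union_comm, Finset.insert_eq]
    have h1 := ih w
    have h2 := two_mul_sum_corr_le A c
    rw [Finset.sum_powerset_insert hi, Finset.card_insert_of_notMem hi, Finset.sum_insert hi,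
      Finset.erase_insert hi, pow_succ]
    have h3 : ∑ k ∈ A, (corr u ((insert i A).erase k) - corr u (insert i A)) =
        ∑ k ∈ A, (corr w (A.erase k) - corr w A) := by
      refine Finset.sum_congr rfl fun k hk => ?_
      rw [hw, hw, Finset.erase_insert_of_ne]
      rintro rfl
      exact hi hk
    have h4 : ∑ S ∈ A.powerset, corr u S =
        ∑ S ∈ A.powerset, corr w S + ∑ S ∈ A.powerset, corr c S := by
      rw [← Finset.sum_add_distrib]
      exact Finset.sum_congr rfl fun S _ => by rw [hw, hc]; ring
    have h5 : ∑ S ∈ A.powerset, corr u (insert i S) = ∑ S ∈ A.powerset, corr w S :=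
      Finset.sum_congr rfl fun S _ => (hw S).symm
    rw [h3, h4, h5]
    have e1 := hw A
    have e2 := hc A
    have e3 := hw ∅
    have e4 := hc ∅
    rw [e2, e4] at h2
    rw [e3, e1] at h1
    rw [e1]
    nlinarith [h1, h2]

/-- The expectation of the product of a function not depending on the coordinate `i` and a function
of the coordinate `i` only. -/
theorem expect_mul_eval [Nonempty Ω] (i : ι) (F : (ι → Ω) → ℝ) (G : Ω → ℝ)
    (hF : ∀ r a, F (Function.update r i a) = F r) :
    𝔼 r, F r * G (r i) = (𝔼 r, F r) * 𝔼 a, G a := by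
  rw [← expect_update i, Finset.expect_mul]
  refine Finset.expect_congr rfl fun r _ => ?_
  simp [hF, Finset.mul_expect]

/-- The second and the fourth moment of a sum of independent centred random variables. -/
theorem moments_sum_eval [Nonempty Ω] (ψ : ι → Ω → ℝ) (κ : ℝ) (hψ : ∀ i, 𝔼 a, ψ i a = 0)
    (hκ : ∀ i a, |ψ i a| ≤ κ) (A : Finset ι) :
    𝔼 r : ι → Ω, (∑ i ∈ A, ψ i (r i)) = 0 ∧
    𝔼 r : ι → Ω, (∑ i ∈ A, ψ i (r i)) ^ 2 = ∑ i ∈ A, 𝔼 a, ψ i a ^ 2 ∧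
    𝔼 r : ι → Ω, (∑ i ∈ A, ψ i (r i)) ^ 4 ≤
      3 * (∑ i ∈ A, 𝔼 a, ψ i a ^ 2) ^ 2 + κ ^ 2 * ∑ i ∈ A, 𝔼 a, ψ i a ^ 2 := by
  induction A using Finset.induction_on with
  | empty => simp
  | insert i A hi ih =>
    obtain ⟨h1, h2, h4⟩ := ih
    set X : (ι → Ω) → ℝ := fun r => ∑ j ∈ A, ψ j (r j)
    have hX : ∀ r a, X (Function.update r i a) = X r := fun r a =>
      Finset.sum_congr rfl fun j hj => by
        rw [Function.update_of_ne (ne_of_mem_of_not_mem hj hi)]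
    have hind : ∀ k l : ℕ, 𝔼 r, X r ^ k * ψ i (r i) ^ l = (𝔼 r, X r ^ k) * 𝔼 a, ψ i a ^ l :=
      fun k l => expect_mul_eval i (fun r => X r ^ k) (fun a => ψ i a ^ l) fun r a => by rw [hX]
    have hins : ∀ r : ι → Ω, ∑ j ∈ insert i A, ψ j (r j) = X r + ψ i (r i) := fun r => by
      rw [Finset.sum_insert hi, add_comm]
    have e01 := hind 0 1
    have e02 := hind 0 2
    have e04 := hind 0 4
    have e11 := hind 1 1
    have e13 := hind 1 3
    have e22 := hind 2 2
    have e31 := hind 3 1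
    simp only [pow_zero, one_mul, pow_one, Fintype.expect_const, hψ, mul_zero, h1, zero_mul]
      at e01 e02 e04 e11 e13 e22 e31
    rw [Finset.sum_insert hi]
    simp only [hins]
    set v := 𝔼 a, ψ i a ^ 2
    have hv : 0 ≤ v := expect_nonneg' fun _ => sq_nonneg _
    have hV : 0 ≤ ∑ j ∈ A, 𝔼 a, ψ j a ^ 2 :=
      Finset.sum_nonneg fun j _ => expect_nonneg' fun _ => sq_nonneg _
    refine ⟨?_, ?_, ?_⟩
    · rw [Finset.expect_add_distrib, h1, e01, add_zero]
    · have : ∀ r, (X r + ψ i (r i)) ^ 2 =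
          X r ^ 2 + 2 * (X r * ψ i (r i)) + ψ i (r i) ^ 2 := fun r => by ring
      simp only [this, Finset.expect_add_distrib, ← Finset.mul_expect, e11, e02]
      rw [h2]; ring
    · have : ∀ r, (X r + ψ i (r i)) ^ 4 = X r ^ 4 + 4 * (X r ^ 3 * ψ i (r i)) +
          6 * (X r ^ 2 * ψ i (r i) ^ 2) + 4 * (X r * ψ i (r i) ^ 3) + ψ i (r i) ^ 4 :=
        fun r => by ring
      simp only [this, Finset.expect_add_distrib, ← Finset.mul_expect, e31, e22, e13, e04]
      have h5 : 𝔼 a, ψ i a ^ 4 ≤ κ ^ 2 * v := by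
        rw [Finset.mul_expect]
        refine expect_mono fun a => ?_
        have : ψ i a ^ 2 ≤ κ ^ 2 := sq_le_sq' (neg_le_of_abs_le (hκ i a)) (le_of_abs_le (hκ i a))
        nlinarith [sq_nonneg (ψ i a)]
      rw [h2]
      nlinarith [mul_nonneg hV hv, sq_nonneg v]

/-- If the first level of the Efron-Stein decomposition of an indicator function is spread out over
coordinates of small influence, then it cannot carry a large part of the variance. -/
theorem level_one_le [Nonempty Ω] (u : (ι → Ω) → ℝ) (hu : ∀ r, u r = 0 ∨ u r = 1) (κ : ℝ)
    (hκ : ∀ i a, |𝔼 s, u (Function.update s i a) - 𝔼 r, u r| ≤ κ)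
    (hsmall : 3 * 𝔼 r, u r + κ ^ 2 ≤ 1 / 64) :
    ∑ i, (corr u (Finset.univ.erase i) - (𝔼 r, u r) ^ 2) ≤ (𝔼 r, u r) / 4 := by
  set μ := 𝔼 r, u r with hμ
  have hμ0 : 0 ≤ μ := expect_nonneg' fun r => by rcases hu r with h | h <;> simp [h]
  set ψ : ι → Ω → ℝ := fun i a => 𝔼 s, u (Function.update s i a) - μ with hψdef
  have hψ0 : ∀ i, 𝔼 a, ψ i a = 0 := fun i => by
    simp only [hψdef, Finset.expect_sub_distrib, Fintype.expect_const]
    rw [Finset.expect_comm, expect_update, hμ, sub_self]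
  have huψ : ∀ i, 𝔼 r, u r * ψ i (r i) = 𝔼 a, ψ i a ^ 2 := fun i => by
    rw [← expect_update i, Finset.expect_comm]
    have : ∀ a, 𝔼 r : ι → Ω, u (Function.update r i a) * ψ i (Function.update r i a i) =
        ψ i a ^ 2 + μ * ψ i a := fun a => by
      simp only [Function.update_self]
      rw [← Finset.expect_mul]
      simp only [hψdef]; ring
    simp only [this, Finset.expect_add_distrib, ← Finset.mul_expect, hψ0]
    ring
  have hcorr : ∀ i, corr u (Finset.univ.erase i) - μ ^ 2 = 𝔼 a, ψ i a ^ 2 := fun i => by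
    have : ∀ r, avg (Finset.univ.erase i) u r = ψ i (r i) + μ := fun r => by
      simp only [hψdef, avg, sub_add_cancel]
      refine Finset.expect_congr rfl fun s _ => congrArg u ?_
      ext j
      by_cases h : j = i
      · subst h; simp
      · simp [h]
    unfold corr
    simp only [this, mul_add, Finset.expect_add_distrib, huψ, ← Finset.expect_mul]
    rw [← hμ]; ring
  simp only [hcorr]
  obtain ⟨-, h2, h4⟩ := moments_sum_eval ψ κ hψ0 hκ Finset.univ
  set X : (ι → Ω) → ℝ := fun r => ∑ j, ψ j (r j)
  set V := ∑ i, 𝔼 a, ψ i a ^ 2 with hVdef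
  have hV : 0 ≤ V := Finset.sum_nonneg fun j _ => expect_nonneg' fun _ => sq_nonneg _
  have huX : 𝔼 r, u r * X r = V := by
    simp only [X, Finset.mul_sum, Finset.expect_sum_comm, huψ]; rfl
  have hu2 : ∀ r, u r ^ 2 = u r := fun r => by rcases hu r with h | h <;> simp [h]
  have hcs : ∀ Y : (ι → Ω) → ℝ, (𝔼 r, u r * Y r) ^ 2 ≤ μ * 𝔼 r, u r * Y r ^ 2 := fun Y => by
    have := Finset.expect_mul_sq_le_sq_mul_sq Finset.univ u fun r => u r * Y r
    simp only [← mul_assoc, ← sq, mul_pow, hu2] at this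
    exact this
  have hu1 : ∀ r, u r ≤ 1 := fun r => by rcases hu r with h | h <;> simp [h]
  -- `X` is the level-one part of `u`, so `V` is both the mean of `u * X` and that of `X ^ 2`. Two
  -- applications of Cauchy-Schwarz and the fourth moment bound give `V ^ 4 ≤ μ ^ 3 * V * (3 * V + κ
  -- ^ 2)`. Since `V ≤ μ`, the last factor is at most `1 / 64`.
  have c1 := hcs X
  have c2 := hcs fun r => X r ^ 2
  have d1 : 𝔼 r, u r * X r ^ 2 ≤ V := by
    rw [← h2]
    exact expect_mono fun r => by nlinarith [hu1 r, sq_nonneg (X r)]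
  have d2 : 𝔼 r, u r * (X r ^ 2) ^ 2 ≤ 3 * V ^ 2 + κ ^ 2 * V := by
    refine le_trans (expect_mono fun r => ?_) h4
    nlinarith [hu1 r, sq_nonneg (X r ^ 2)]
  set Z := 𝔼 r, u r * X r ^ 2
  have hZ : 0 ≤ Z := expect_nonneg' fun r => by
    rcases hu r with h | h <;> simp [h, sq_nonneg]
  rw [huX] at c1
  by_contra! hlt
  have hVpos : 0 < V := lt_of_le_of_lt (by positivity) hlt
  have hVμ : V ≤ μ := by
    have : V ^ 2 ≤ μ * V := c1.trans (mul_le_mul_of_nonneg_left d1 hμ0)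
    nlinarith
  have e1 : Z ^ 2 ≤ μ * (V * (1 / 64)) := by
    refine c2.trans (mul_le_mul_of_nonneg_left (d2.trans ?_) hμ0)
    nlinarith
  have e2 : V ^ 4 ≤ μ ^ 3 * V / 64 := by
    have : (V ^ 2) ^ 2 ≤ (μ * Z) ^ 2 := pow_le_pow_left₀ (sq_nonneg _) c1 2
    have : μ ^ 2 * Z ^ 2 ≤ μ ^ 2 * (μ * (V * (1 / 64))) :=
      mul_le_mul_of_nonneg_left e1 (sq_nonneg _)
    nlinarith
  have e3 : V ^ 3 ≤ μ ^ 3 / 64 := by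
    have : V * V ^ 3 ≤ V * (μ ^ 3 / 64) := by nlinarith
    exact le_of_mul_le_mul_left this hVpos
  have e4 : (μ / 4) ^ 3 < V ^ 3 := pow_lt_pow_left₀ hlt (by positivity) (by norm_num)
  have e5 : (μ / 4) ^ 3 = μ ^ 3 / 64 := by ring
  linarith

end Product

/-! ### Functions with small defects are nearly functions of one coordinate -/

/-- The pairs `a, b` and `c, d` are equal as multisets. -/
def Balanced {L : Type*} (a b c d : L) : Prop := ∀ φ : L → ℝ, φ a + φ b = φ c + φ d

/-- Test functions allow balance relations to be added and subtracted; indicator functions recover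
the equality of multisets. -/
theorem Balanced.eq_or {L : Type*} {a b c d : L} (h : Balanced a b c d) :
    (a = c ∧ b = d) ∨ (a = d ∧ b = c) := by
  classical
  have key : ∀ {x y : L}, (∀ φ : L → ℝ, φ x = φ y) → x = y := fun {x y} h => by
    by_contra hne
    have := h fun z => if z = x then 1 else 0
    simp [Ne.symm hne] at this
  by_cases hc : a = c
  · subst hc
    exact Or.inl ⟨rfl, key fun φ => by have := h φ; linarith⟩
  · by_cases hd : a = d
    · subst hd
      exact Or.inr ⟨rfl, key fun φ => by have := h φ; linarith⟩
    · have h1 := h fun z => if z = a then 1 else 0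
      simp only [if_true, if_neg (Ne.symm hc), if_neg (Ne.symm hd)] at h1
      split_ifs at h1 <;> norm_num at h1

section Dichotomy

variable {ι Ω L : Type*} [Fintype ι] [DecidableEq ι]

theorem piecewise_compl_eq (S : Finset ι) (r s : ι → Ω) :
    Sᶜ.piecewise s r = S.piecewise r s := by
  ext i; by_cases h : i ∈ S <;> simp [h]

variable [Fintype Ω]

/-- The probability that the value of `g` changes when the coordinates in `S` are resampled. -/
noncomputable def flip (g : (ι → Ω) → L) (S : Finset ι) : ℝ :=
  𝔼 r, 𝔼 s, ind (g r ≠ g (S.piecewise s r))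

/-- The probability that the values of `g` at two random points and at the two points obtained by
exchanging the coordinates in `S` are not balanced. -/
noncomputable def defect (g : (ι → Ω) → L) (S : Finset ι) : ℝ :=
  𝔼 r, 𝔼 s, ind (¬Balanced (g r) (g s) (g (S.piecewise s r)) (g (S.piecewise r s)))

theorem le_card_mul_expect (h : Ω → ℝ) (hh : ∀ a, 0 ≤ h a) (a : Ω) :
    h a ≤ Fintype.card Ω * 𝔼 b, h b := by
  rw [Fintype.card_mul_expect]
  exact Finset.single_le_sum (fun b _ => hh b) (Finset.mem_univ a)

theorem flip_nonneg (g : (ι → Ω) → L) (S : Finset ι) : 0 ≤ flip g S :=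
  expect_nonneg' fun _ => expect_nonneg' fun _ => ind_nonneg _

theorem flip_empty (g : (ι → Ω) → L) : flip g ∅ = 0 := by
  simp [flip, ind]

theorem flip_union_le (g : (ι → Ω) → L) {S T : Finset ι} (h : Disjoint S T) :
    flip g (S ∪ T) ≤ flip g S + flip g T := by
  have e := expect_exchange S fun r s => ind (g r ≠ g (T.piecewise s r))
  unfold flip
  rw [← e]
  simp only [← Finset.expect_add_distrib]
  refine expect_mono fun r => expect_mono fun s => ?_
  have hp : T.piecewise (S.piecewise r s) (S.piecewise s r) = (S ∪ T).piecewise s r := by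
    ext i
    by_cases hS : i ∈ S
    · simp [hS, Finset.disjoint_left.1 h hS]
    · by_cases hT : i ∈ T <;> simp [hS, hT]
  rw [hp]
  refine (ind_mono fun hne => ?_).trans (ind_or_le _ _)
  by_contra! hcon
  exact hne (hcon.1.trans hcon.2)

/-- As resampling one coordinate hardly matters, the flip probabilities of subsets take values in
every short interval up to the flip probability of the whole set. -/
theorem exists_flip_mem_Icc (g : (ι → Ω) → L) {θ t : ℝ} (hθ : ∀ i, flip g {i} ≤ θ)
    (hθ0 : 0 ≤ θ) (ht : 0 ≤ t) (A : Finset ι) (hA : t ≤ flip g A) :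
    ∃ S, t ≤ flip g S ∧ flip g S ≤ t + θ := by
  induction A using Finset.induction_on with
  | empty => exact ⟨∅, hA, by rw [flip_empty]; linarith⟩
  | insert i A hi ih =>
    by_cases h : t ≤ flip g A
    · exact ih h
    · refine ⟨insert i A, hA, ?_⟩
      have := flip_union_le g (Finset.disjoint_singleton_left.2 hi)
      rw [← Finset.insert_eq] at this
      linarith [hθ i, not_le.1 h]

variable [Nonempty Ω]

theorem expect_piecewise' (S : Finset ι) (h : (ι → Ω) → ℝ) :
    𝔼 s, 𝔼 r, h (S.piecewise s r) = 𝔼 r, h r := by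
  rw [Finset.expect_comm, expect_piecewise]

/-- Write `g(a,b)` for the value at the point agreeing with `a` on `S` and with `b` off `S`. Suppose
that `g(r,r) ≠ g(s,r)` and `g(r',r') ≠ g(r',s')`. Balance on the rectangles `{r,s} × {r,r'}` and
`{r,r'} × {r',s'}` carries these inequalities to `g(r,r') ≠ g(s,r')` and `g(r,r') ≠ g(r,s')`, which
contradicts balance on `{r,s} × {r',s'}`. Each rectangle is uniformly distributed, whence the factor
3. -/
theorem flip_mul_flip_compl_le (g : (ι → Ω) → L) (S : Finset ι) :
    flip g S * flip g Sᶜ ≤ 3 * defect g S := by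
  set K : (ι → Ω) → (ι → Ω) → ℝ := fun r s =>
    ind (¬Balanced (g r) (g s) (g (S.piecewise s r)) (g (S.piecewise r s)))
  have hdef : defect g S = 𝔼 r, 𝔼 s, K r s := rfl
  have hP : ∀ z, 𝔼 r, 𝔼 s, K z (S.piecewise r s) = 𝔼 s, K z s := fun z =>
    expect_piecewise' S (K z)
  have e1 : 𝔼 r, 𝔼 s, 𝔼 r', 𝔼 _s' : ι → Ω, K r (S.piecewise s r') = defect g S := by
    simp only [Fintype.expect_const, hP, hdef]
  have e2 : 𝔼 r, 𝔼 _s : ι → Ω, 𝔼 r', 𝔼 s', K r' (S.piecewise r s') = defect g S := by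
    simp only [Fintype.expect_const]
    rw [Finset.expect_comm]
    refine Finset.expect_congr rfl fun r' _ => hP r'
  have e3 : 𝔼 r, 𝔼 s, 𝔼 r', 𝔼 s', K (S.piecewise r r') (S.piecewise s s') = defect g S := by
    have : ∀ r, 𝔼 s, 𝔼 r', 𝔼 s', K (S.piecewise r r') (S.piecewise s s') =
        𝔼 r', 𝔼 s, K (S.piecewise r r') s := fun r => by
      rw [Finset.expect_comm]
      exact Finset.expect_congr rfl fun r' _ => hP _
    simp only [this]
    exact expect_piecewise' S fun z => 𝔼 s, K z s
  have e : 3 * defect g S = 𝔼 r, 𝔼 s, 𝔼 r', 𝔼 s', (K r (S.piecewise s r') +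
      K r' (S.piecewise r s') + K (S.piecewise r r') (S.piecewise s s')) := by
    simp only [Finset.expect_add_distrib, e1, e2, e3]; ring
  rw [e]
  unfold flip
  simp only [Finset.expect_mul]
  simp only [Finset.mul_expect]
  refine expect_mono fun r => expect_mono fun s => expect_mono fun r' => expect_mono fun s' => ?_
  rw [← ind_and]
  refine (ind_mono fun hne => ?_).trans ((ind_or_le _ _).trans
    (add_le_add_left (ind_or_le _ _) _))
  by_contra! hcon
  obtain ⟨⟨b1, b2⟩, b3⟩ := hcon
  obtain ⟨hA, hB⟩ := hne
  rw [piecewise_compl_eq] at hB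
  have p1 : S.piecewise (S.piecewise s r') r = S.piecewise s r := by
    ext i; by_cases h : i ∈ S <;> simp [h]
  have p2 : S.piecewise r (S.piecewise s r') = S.piecewise r r' := by
    ext i; by_cases h : i ∈ S <;> simp [h]
  have p3 : S.piecewise (S.piecewise r s') r' = S.piecewise r r' := by
    ext i; by_cases h : i ∈ S <;> simp [h]
  have p4 : S.piecewise r' (S.piecewise r s') = S.piecewise r' s' := by
    ext i; by_cases h : i ∈ S <;> simp [h]
  have p5 : S.piecewise (S.piecewise s s') (S.piecewise r r') = S.piecewise s r' := by
    ext i; by_cases h : i ∈ S <;> simp [h]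
  have p6 : S.piecewise (S.piecewise r r') (S.piecewise s s') = S.piecewise r s' := by
    ext i; by_cases h : i ∈ S <;> simp [h]
  rw [p1, p2] at b1
  rw [p3, p4] at b2
  rw [p5, p6] at b3
  rcases b1.eq_or with ⟨h1, -⟩ | ⟨h1, h1'⟩
  · exact hA h1
  rcases b2.eq_or with ⟨h2, h2'⟩ | ⟨h2, -⟩
  swap
  · exact hB h2
  rcases b3.eq_or with ⟨h3, -⟩ | ⟨h3, -⟩
  · exact hA (by rw [h1, h3, h1'])
  · exact hB (by rw [h2, h3, h2'])

/-- Otherwise some `S` has flip probability about a quarter of the total; then by subadditivity both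
`S` and its complement are too influential for `flip_mul_flip_compl_le`. -/
theorem flip_univ_le (g : (ι → Ω) → L) {η θ : ℝ} (hη : ∀ S, defect g S ≤ η) (hθ0 : 0 < θ)
    (hθ : ∀ i, flip g {i} ≤ θ) (hηθ : 3 * η < 2 * θ ^ 2) : flip g Finset.univ ≤ 4 * θ := by
  by_contra! hlt
  set p := flip g Finset.univ
  obtain ⟨S, h1, h2⟩ := exists_flip_mem_Icc g hθ hθ0.le (t := p / 4) (by linarith) Finset.univ
    (by linarith)
  have h3 := flip_union_le g (disjoint_compl_right (a := S))
  rw [Finset.union_compl] at h3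
  have h4 := flip_mul_flip_compl_le g S
  have h5 : θ * (2 * θ) ≤ flip g S * flip g Sᶜ :=
    mul_le_mul (by linarith) (by linarith) (by linarith) (flip_nonneg g S)
  nlinarith [hη S]

theorem flip_singleton (g : (ι → Ω) → L) (i : ι) :
    flip g {i} = 𝔼 a, 𝔼 r, 𝔼 b, ind (g (Function.update r i a) ≠ g (Function.update r i b)) := by
  rw [Finset.expect_comm]
  have := expect_update i fun r => 𝔼 b, ind (g r ≠ g (Function.update r i b))
  simp only [Function.update_idem] at this
  rw [this]
  unfold flip
  refine Finset.expect_congr rfl fun r _ => ?_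
  simp only [Finset.piecewise_singleton]
  exact expect_eval i fun a => ind (g r ≠ g (Function.update r i a))

/-- A function with small defects all of whose coordinates have small influence is nearly
constant. -/
theorem exists_near_const (g : (ι → Ω) → L) {η θ : ℝ} (hη : ∀ S, defect g S ≤ η) (hθ0 : 0 < θ)
    (hθ : ∀ i, flip g {i} ≤ θ) (hηθ : 3 * η < 2 * θ ^ 2)
    (hcard : Fintype.card Ω * θ ≤ 1 / 1000) :
    ∃ c, pr (fun r => g r ≠ c) ≤ 8 * η := by
  have hflip := flip_univ_le g hη hθ0 hθ hηθ
  have hθ1 : θ ≤ 1 / 1000 := by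
    have : (1 : ℝ) ≤ Fintype.card Ω := by exact_mod_cast Fintype.card_pos
    nlinarith
  unfold flip at hflip
  rw [Finset.expect_comm] at hflip
  obtain ⟨s, -, hs⟩ := Finset.exists_le_of_expect_le Finset.univ_nonempty hflip
  simp only [Finset.piecewise_univ] at hs
  -- So far this constant is only known to be at distance at most `4 * θ`; the rest improves this to
  -- `8 * η`.
  refine ⟨g s, ?_⟩
  set u : (ι → Ω) → ℝ := fun r => ind (g r ≠ g s) with hu
  have hu01 : ∀ r, u r = 0 ∨ u r = 1 := fun r => by
    by_cases h : g r = g s <;> simp [hu, ind, h]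
  set μ := 𝔼 r, u r with hμ
  change μ ≤ 8 * η
  have hμ0 : 0 ≤ μ := expect_nonneg' fun r => ind_nonneg _
  -- Fixing a coordinate at `a` instead of averaging over its values costs a factor `Fintype.card
  -- Ω`.
  have hκ : ∀ i a, |𝔼 s, u (Function.update s i a) - 𝔼 r, u r| ≤ 1 / 1000 := fun i a => by
    have h1 := le_card_mul_expect (fun a => 𝔼 r : ι → Ω, 𝔼 b,
      ind (g (Function.update r i a) ≠ g (Function.update r i b)))
      (fun a => expect_nonneg' fun _ => expect_nonneg' fun _ => ind_nonneg _) a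
    rw [← flip_singleton] at h1
    have h2 : 𝔼 s, u (Function.update s i a) - 𝔼 r, u r =
        𝔼 r, 𝔼 b, (u (Function.update r i a) - u (Function.update r i b)) := by
      simp only [Finset.expect_sub_distrib, Fintype.expect_const]
      rw [expect_update i u]
    rw [h2]
    refine le_trans ?_ (h1.trans ((mul_le_mul_of_nonneg_left (hθ i) (Nat.cast_nonneg _)).trans
      hcard))
    refine (Finset.abs_expect_le _ _).trans (expect_mono fun r => ?_)
    refine (Finset.abs_expect_le _ _).trans (expect_mono fun b => ?_)
    by_cases h : g (Function.update r i a) = g (Function.update r i b)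
    · have : u (Function.update r i a) = u (Function.update r i b) := by simp only [hu, h]
      rw [this, sub_self, abs_zero]
      exact ind_nonneg _
    · rw [ind_true h]
      rcases hu01 (Function.update r i a) with h1 | h1 <;>
        rcases hu01 (Function.update r i b) with h2 | h2 <;> rw [h1, h2] <;> norm_num
  have hV := level_one_le u hu01 (1 / 1000) hκ (by rw [← hμ]; nlinarith)
  rw [← hμ] at hV
  have hc0 : corr u ∅ = μ := by
    unfold corr
    rw [avg_empty]
    exact Finset.expect_congr rfl fun r _ => by rcases hu01 r with h | h <;> rw [h] <;> norm_num
  have hc1 : corr u Finset.univ = μ ^ 2 := by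
    simp only [corr, avg, Finset.piecewise_univ, ← hμ, ← Finset.expect_mul]; ring
  have hsum := four_mul_sum_corr_le Finset.univ u
  rw [hc0, hc1] at hsum
  -- The difference is the mean of a quantity that vanishes on balanced exchanges and is at most 2
  -- on the others.
  have hS : ∀ S, μ + μ ^ 2 - 2 * η ≤ corr u S + corr u Sᶜ := fun S => by
    have h1 : μ + μ ^ 2 - (corr u S + corr u Sᶜ) =
        𝔼 r, 𝔼 s, u r * (u r + u s - u (S.piecewise s r) - u (S.piecewise r s)) := by
      rw [← hc1, ← hc0]
      simp only [corr, avg, Finset.mul_expect, mul_sub, mul_add,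
        Finset.expect_add_distrib, Finset.expect_sub_distrib, Finset.piecewise_univ,
        piecewise_compl_eq, Finset.piecewise_empty]
      ring
    have h2 : 𝔼 r, 𝔼 s, u r * (u r + u s - u (S.piecewise s r) - u (S.piecewise r s)) ≤
        2 * defect g S := by
      unfold defect
      rw [Finset.mul_expect]
      refine expect_mono fun r => ?_
      rw [Finset.mul_expect]
      refine expect_mono fun t => ?_
      by_cases hb : Balanced (g r) (g t) (g (S.piecewise t r)) (g (S.piecewise r t))
      · have := hb fun z => ind (z ≠ g s)
        rw [ind_false (not_not.2 hb)]
        have hz : u r + u t - u (S.piecewise t r) - u (S.piecewise r t) = 0 := by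
          simp only [hu]; linarith
        rw [hz, mul_zero, mul_zero]
      · rw [ind_true hb]
        rcases hu01 r with h | h <;> rw [h]
        · norm_num
        · have a1 : u t ≤ 1 := ind_le_one _
          have a2 : 0 ≤ u (S.piecewise t r) := ind_nonneg _
          have a3 : 0 ≤ u (S.piecewise r t) := ind_nonneg _
          linarith
    linarith [hη S]
  have hcompl : ∑ S : Finset ι, corr u Sᶜ = ∑ S : Finset ι, corr u S :=
    Fintype.sum_equiv (Function.Involutive.toPerm _ compl_involutive) _ _ fun _ => rfl
  have hsum2 : ∑ _S : Finset ι, (μ + μ ^ 2 - 2 * η) ≤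
      ∑ S : Finset ι, (corr u S + corr u Sᶜ) := Finset.sum_le_sum fun S _ => hS S
  rw [Finset.sum_add_distrib, hcompl, Finset.sum_const, Finset.card_univ, Fintype.card_finset,
    nsmul_eq_mul] at hsum2
  push_cast at hsum2
  rw [Finset.powerset_univ, Finset.card_univ] at hsum
  set N : ℝ := 2 ^ Fintype.card ι
  set V := ∑ i, (corr u (Finset.univ.erase i) - μ ^ 2)
  have hN : 0 < N := by positivity
  -- With `V ≤ μ / 4` this becomes `3 * μ / 4 - μ ^ 2 ≤ 4 * η`, and `μ ≤ 1 / 4` then yields `μ ≤ 8 *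
  -- η`.
  have hfin : 2 * (μ + μ ^ 2 - 2 * η) ≤ V + μ + 3 * μ ^ 2 := by
    refine le_of_mul_le_mul_left ?_ hN
    linarith
  have hμ1 : μ ≤ 1 / 4 := by
    have : μ ≤ 4 * θ := hs
    linarith
  nlinarith

/-- As `i` is influential, the other coordinates jointly are not, so they can be frozen at a
suitable point. -/
theorem exists_near_dictator (g : (ι → Ω) → L) {η θ : ℝ} {i : ι} (hη : defect g {i} ≤ η)
    (hθ0 : 0 < θ) (hi : θ ≤ flip g {i}) :
    ∃ h : Ω → L, pr (fun r => g r ≠ h (r i)) ≤ 3 * η / θ := by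
  have h1 := flip_mul_flip_compl_le g {i}
  have h2 : flip g {i}ᶜ ≤ 3 * η / θ := by
    rw [le_div_iff₀ hθ0]
    nlinarith [flip_nonneg g {i}ᶜ]
  unfold flip at h2
  rw [Finset.expect_comm] at h2
  obtain ⟨s, -, hs⟩ := Finset.exists_le_of_expect_le Finset.univ_nonempty h2
  refine ⟨fun a => g (Function.update s i a), ?_⟩
  simp only [piecewise_compl_eq, Finset.piecewise_singleton] at hs
  exact hs

/-- A function on a nonempty power with small defects is nearly a function of one coordinate. -/
theorem exists_near_eval [Nonempty ι] (g : (ι → Ω) → L) {η : ℝ} (hη : ∀ S, defect g S ≤ η)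
    (hsmall : 2000000 * (Fintype.card Ω : ℝ) ^ 2 * η < 1) :
    ∃ (i : ι) (h : Ω → L), pr (fun r => g r ≠ h (r i)) ≤ 3000 * Fintype.card Ω * η := by
  have hm : (1 : ℝ) ≤ Fintype.card Ω := by exact_mod_cast Fintype.card_pos
  set m : ℝ := (Fintype.card Ω : ℝ)
  have hη0 : 0 ≤ η := le_trans (expect_nonneg' fun _ => expect_nonneg' fun _ => ind_nonneg _)
    (hη ∅)
  have hθ0 : 0 < 1 / (1000 * m) := by positivity
  by_cases h : ∃ i, 1 / (1000 * m) ≤ flip g {i}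
  · obtain ⟨i, hi⟩ := h
    obtain ⟨h, hh⟩ := exists_near_dictator g (hη _) hθ0 hi
    exact ⟨i, h, hh.trans (le_of_eq (by field_simp; ring))⟩
  · push Not at h
    obtain ⟨c, hc⟩ := exists_near_const g hη hθ0 (fun i => (h i).le)
      (by rw [div_pow, ← mul_div_assoc, lt_div_iff₀ (by positivity)]; nlinarith)
      (le_of_eq (by change m * _ = _; field_simp))
    exact ⟨Classical.arbitrary ι, fun _ => c, hc.trans (by nlinarith)⟩

end Dichotomy

/-! ### Outcomes as assignments of parts to alternatives -/

section Outcomes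

variable {m : ℕ} {L : Type*}

theorem IsFixing.exists_lab {H : Subgroup (Ranking m)} (h : IsFixing H) :
    ∃ lab : Fin m → Finset (Fin m), ∀ σ : Ranking m, σ ∈ H ↔ ∀ a, lab (σ a) = lab a := by
  obtain ⟨P, -, hP⟩ := h
  refine ⟨P.part, fun σ => (hP σ).trans ⟨fun h a => ?_, fun h B hB a ha => ?_⟩⟩
  · exact P.part_eq_of_mem (P.part_mem.2 (Finset.mem_univ a))
      (h _ (P.part_mem.2 (Finset.mem_univ a)) a (P.mem_part (Finset.mem_univ a)))
  · rw [← P.part_eq_of_mem hB ha, ← h a]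
    exact P.mem_part (Finset.mem_univ _)

/-- The label of the part of the ranks in which the alternative `j` is placed by an outcome. -/
noncomputable def partOf {H : Subgroup (Ranking m)} (lab : Fin m → L) (K : Outcome H)
    (j : Fin m) : L :=
  lab (K.out⁻¹ j)

variable {H : Subgroup (Ranking m)} {lab : Fin m → L}

theorem partOf_mk (hlab : ∀ σ : Ranking m, σ ∈ H ↔ ∀ a, lab (σ a) = lab a) (y : Ranking m)
    (j : Fin m) : partOf lab (QuotientGroup.mk y : Outcome H) j = lab (y⁻¹ j) := by
  obtain ⟨h, hh⟩ := QuotientGroup.mk_out_eq_mul H y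
  unfold partOf
  rw [hh, mul_inv_rev, Equiv.Perm.mul_apply]
  exact (hlab _).1 (H.inv_mem h.2) _

theorem eq_of_partOf_eq (hlab : ∀ σ : Ranking m, σ ∈ H ↔ ∀ a, lab (σ a) = lab a)
    {K K' : Outcome H} (h : ∀ j, partOf lab K j = partOf lab K' j) : K = K' := by
  rw [← QuotientGroup.out_eq' K, ← QuotientGroup.out_eq' K', QuotientGroup.eq, hlab]
  intro a
  have := h (Quotient.out K' a)
  simpa [partOf] using this

theorem partOf_eq_of_profile_eq (hlab : ∀ σ : Ranking m, σ ∈ H ↔ ∀ a, lab (σ a) = lab a)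
    {K K' : Outcome H} {j : Fin m} (h : profile H j K = profile H j K') :
    partOf lab K j = partOf lab K' j := by
  have hmem : K.out⁻¹ j ∈ profile H j K := by
    unfold profile
    refine Multiset.mem_map.2 ⟨K.out, ?_, rfl⟩
    simp
  rw [h] at hmem
  obtain ⟨y, hy, hyj⟩ := Multiset.mem_map.1 hmem
  have hy' : (QuotientGroup.mk y : Outcome H) = K' := by simpa using hy
  rw [← hy', partOf_mk hlab, hyj]
  rfl

theorem sum_partOf (K : Outcome H) (φ : L → ℝ) :
    ∑ j, φ (partOf lab K j) = ∑ a, φ (lab a) :=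
  Fintype.sum_equiv (K.out⁻¹ : Ranking m) _ _ fun _ => rfl

/-- The conservation law: each part receives as many alternatives as it has ranks, in every outcome.
-/
theorem balanced_partOf {K K' : Outcome H} {j k : Fin m} (hjk : j ≠ k)
    (h : ∀ o, o ≠ j → o ≠ k → partOf lab K o = partOf lab K' o) :
    Balanced (partOf lab K j) (partOf lab K k) (partOf lab K' j) (partOf lab K' k) := by
  intro φ
  have e := (sum_partOf K φ).trans (sum_partOf (lab := lab) K' φ).symm
  have hk : k ∈ Finset.univ.erase j := Finset.mem_erase.2 ⟨hjk.symm, Finset.mem_univ _⟩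
  rw [← Finset.add_sum_erase _ _ (Finset.mem_univ j), ← Finset.add_sum_erase _ _ hk,
    ← Finset.add_sum_erase (a := j) Finset.univ (fun o => φ (partOf lab K' o))
      (Finset.mem_univ j),
    ← Finset.add_sum_erase (a := k) _ (fun o => φ (partOf lab K' o)) hk] at e
  have : ∑ o ∈ (Finset.univ.erase j).erase k, φ (partOf lab K o) =
      ∑ o ∈ (Finset.univ.erase j).erase k, φ (partOf lab K' o) :=
    Finset.sum_congr rfl fun o ho => by
      simp only [Finset.mem_erase] at ho
      rw [h o ho.2.1 ho.1]
  linarith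

end Outcomes

/-! ### From manipulation power to functions of ranks -/

section Votes

variable {n m : ℕ} {L : Type*}

theorem expect_mul_left {G : Type*} [Group G] [Fintype G] (a : G) (h : G → ℝ) :
    𝔼 x, h (a * x) = 𝔼 x, h x :=
  expect_comp_equiv (Equiv.mulLeft a) h

theorem expect_mul_right {G : Type*} [Group G] [Fintype G] (a : G) (h : G → ℝ) :
    𝔼 x, h (x * a) = 𝔼 x, h x :=
  expect_comp_equiv (Equiv.mulRight a) h

/-- The element of a power of a group with the coordinate `i` equal to `a` and the other ones
trivial. -/
abbrev single {ι G : Type*} [DecidableEq ι] [Group G] (i : ι) (a : G) : ι → G := Pi.mulSingle i a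

/-- The hybrid argument: a change of all votes by a fixed group element is detected with at most
the sum of the probabilities of detecting the changes of the single votes. -/
theorem expect_ne_mul_le {ι G : Type*} [Fintype ι] [DecidableEq ι] [Group G] [Fintype G]
    (F : (ι → G) → L) (τ : ι → G) :
    𝔼 x, ind (F x ≠ F (τ * x)) ≤ ∑ i, 𝔼 x, ind (F x ≠ F (single i (τ i) * x)) := by
  have key : ∀ A : Finset ι, 𝔼 x, ind (F x ≠ F (A.piecewise τ 1 * x)) ≤
      ∑ i ∈ A, 𝔼 x, ind (F x ≠ F (single i (τ i) * x)) := by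
    intro A
    induction A using Finset.induction_on with
    | empty => simp [ind]
    | insert i A hi ih =>
      rw [Finset.sum_insert hi]
      have h1 : (insert i A).piecewise τ 1 = single i (τ i) * A.piecewise τ 1 := by
        ext j
        by_cases hj : j = i
        · subst hj; simp [hi]
        · by_cases hA : j ∈ A <;> simp [hj, hA]
      rw [← expect_mul_left (A.piecewise τ 1)
        fun x : ι → G => ind (F x ≠ F (single i (τ i) * x)), add_comm]
      refine le_trans ?_ (add_le_add_left ih _)
      rw [← Finset.expect_add_distrib]
      refine expect_mono fun x => (ind_mono fun hne => ?_).trans (ind_or_le _ _)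
      by_contra! hcon
      rw [h1, mul_assoc] at hne
      exact hne (hcon.1.trans hcon.2)
  simpa using key Finset.univ

/-- A permutation fixing `j` which is obtained from `σ` by moving the image of `j`. -/
def fixer (j : Fin m) (σ : Ranking m) : Ranking m := Equiv.swap (σ j) j * σ

theorem fixer_apply (j : Fin m) (σ : Ranking m) : fixer j σ j = j := by
  simp [fixer]

/-- `fixer j` maps the uniform distribution to the uniform one on the stabilizer of `j`, whose
density is `1 / m`. -/
theorem expect_fixer (j : Fin m) (h : Ranking m → ℝ) :
    𝔼 σ, h (fixer j σ) = m * 𝔼 σ : Ranking m, ind (σ j = j) * h σ := by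
  have h1 : ∀ σ : Ranking m, h (fixer j σ) = ∑ k, ind (σ j = k) * h (Equiv.swap k j * σ) := by
    intro σ
    rw [Finset.sum_eq_single (σ j)]
    · rw [ind_true rfl, one_mul]; rfl
    · intro k _ hk
      rw [ind_false hk.symm, zero_mul]
    · simp
  have h2 : ∀ k, 𝔼 σ : Ranking m, ind (σ j = k) * h (Equiv.swap k j * σ) =
      𝔼 σ : Ranking m, ind (σ j = j) * h σ := by
    intro k
    rw [← expect_mul_left (Equiv.swap k j)]
    refine Finset.expect_congr rfl fun σ _ => ?_
    rw [← mul_assoc, Equiv.swap_mul_self, one_mul]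
    congr 2
    rw [Equiv.Perm.mul_apply, Equiv.swap_apply_eq_iff, Equiv.swap_apply_left]
  simp only [h1, Finset.expect_sum_comm, h2, Finset.sum_const, Finset.card_univ,
    Fintype.card_fin, nsmul_eq_mul]

theorem expect_fixer_le (j : Fin m) (h : Ranking m → ℝ) (hh : ∀ σ, 0 ≤ h σ) :
    𝔼 σ, h (fixer j σ) ≤ m * 𝔼 σ, h σ := by
  rw [expect_fixer]
  refine mul_le_mul_of_nonneg_left (expect_mono fun σ => ?_) (Nat.cast_nonneg _)
  exact mul_le_of_le_one_left (hh σ) (ind_le_one _)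

/-- If a vote is changed without moving `j`, then one of the two orders of the old and the new vote
is a manipulation, unless the value does not change. -/
theorem expect_ne_fixer_le {Q : Type*} (lt : Fin m → Q → Q → Prop)
    (hlt : ∀ r, IsStrictTotalOrder Q (lt r)) (F : (Fin n → Ranking m) → L)
    (q : (Fin n → Ranking m) → Q) (hq : ∀ x y, q x = q y → F x = F y) (i : Fin n) (j : Fin m) :
    𝔼 σ, 𝔼 x, ind (F x ≠ F (single i (fixer j σ) * x)) ≤
      2 * m * 𝔼 x, 𝔼 y, ind (lt ((x i)⁻¹ j) (q x) (q (Function.update x i y))) := by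
  set A : (Fin n → Ranking m) → Ranking m → ℝ := fun x τ =>
    ind (lt ((x i)⁻¹ j) (q x) (q (single i τ * x))) with hA
  have hupd : ∀ (x : Fin n → Ranking m) (τ : Ranking m),
      single i τ * x = Function.update x i (τ * x i) := fun x τ => by
    ext k : 1
    by_cases hk : k = i
    · subst hk; simp
    · simp [hk]
  have hM : ∀ x, 𝔼 y, ind (lt ((x i)⁻¹ j) (q x) (q (Function.update x i y))) = 𝔼 τ, A x τ :=
    fun x => by
      simp only [hA, hupd]
      exact (expect_mul_right (x i)
        fun y => ind (lt ((x i)⁻¹ j) (q x) (q (Function.update x i y)))).symm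
  -- The change of the vote fixes `j`, so the same order judges it and its reversal.
  have hpt : ∀ σ x, ind (F x ≠ F (single i (fixer j σ) * x)) ≤
      A x (fixer j σ) + A (single i (fixer j σ) * x) (fixer j σ)⁻¹ := by
    intro σ x
    set τ := fixer j σ
    have e1 : single i τ⁻¹ * (single i τ * x) = x := by
      rw [← mul_assoc, ← Pi.mulSingle_mul, inv_mul_cancel, Pi.mulSingle_one, one_mul]
    have e2 : ((single i τ * x : Fin n → Ranking m) i)⁻¹ j = (x i)⁻¹ j := by
      have : τ⁻¹ j = j := Equiv.Perm.inv_eq_iff_eq.2 (fixer_apply j σ).symm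
      rw [hupd, Function.update_self, mul_inv_rev, Equiv.Perm.mul_apply, this]
    simp only [hA, e1, e2]
    refine (ind_mono fun hne => ?_).trans (ind_or_le _ _)
    have := hlt ((x i)⁻¹ j)
    rcases trichotomous_of (lt ((x i)⁻¹ j)) (q x) (q (single i τ * x)) with h | h | h
    · exact Or.inl h
    · exact absurd (hq _ _ h) hne
    · exact Or.inr h
  have h1 : 𝔼 σ, 𝔼 x, A x (fixer j σ) ≤ m * 𝔼 x, 𝔼 τ, A x τ := by
    rw [Finset.expect_comm, Finset.mul_expect]
    exact expect_mono fun x => expect_fixer_le j (A x) fun _ => ind_nonneg _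
  have h2 : 𝔼 σ, 𝔼 x, A (single i (fixer j σ) * x) (fixer j σ)⁻¹ ≤
      m * 𝔼 x, 𝔼 τ, A x τ := by
    have e : ∀ σ, 𝔼 x, A (single i (fixer j σ) * x) (fixer j σ)⁻¹ =
        𝔼 x, A x (fixer j σ)⁻¹ := fun σ =>
      expect_mul_left _ fun x => A x (fixer j σ)⁻¹
    simp only [e]
    rw [Finset.expect_comm, Finset.mul_expect]
    refine expect_mono fun x =>
      (expect_fixer_le j (fun τ => A x τ⁻¹) fun _ => ind_nonneg _).trans (le_of_eq ?_)
    congr 1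
    exact expect_comp_equiv (Equiv.inv (Ranking m)) (A x)
  simp only [hM]
  refine (expect_mono fun σ => expect_mono fun x => hpt σ x).trans ?_
  simp only [Finset.expect_add_distrib]
  linarith

/-- The ranks of the alternative `k` in the votes `x`. -/
def ranks (k : Fin m) (x : Fin n → Ranking m) (i : Fin n) : Fin m := (x i)⁻¹ k

/-- A function of the votes which is hard to manipulate according to the rank of `j` is nearly a
function of the ranks of `j`. -/
theorem exists_near_ranks {Q : Type*} (lt : Fin m → Q → Q → Prop)
    (hlt : ∀ r, IsStrictTotalOrder Q (lt r)) (F : (Fin n → Ranking m) → L)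
    (q : (Fin n → Ranking m) → Q) (hq : ∀ x y, q x = q y → F x = F y) (j : Fin m) :
    ∃ g : (Fin n → Fin m) → L, pr (fun x => F x ≠ g (ranks j x)) ≤
      2 * m * ∑ i, 𝔼 x, 𝔼 y, ind (lt ((x i)⁻¹ j) (q x) (q (Function.update x i y))) := by
  have h1 : 𝔼 σ : Fin n → Ranking m, 𝔼 x, ind (F x ≠ F ((fun i => fixer j (σ i)) * x)) ≤
      2 * m * ∑ i, 𝔼 x, 𝔼 y, ind (lt ((x i)⁻¹ j) (q x) (q (Function.update x i y))) := by
    refine (expect_mono fun σ : Fin n → Ranking m =>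
      expect_ne_mul_le (ι := Fin n) (G := Ranking m) F fun i => fixer j (σ i)).trans ?_
    rw [Finset.expect_sum_comm, Finset.mul_sum]
    refine Finset.sum_le_sum fun i _ => le_trans (le_of_eq ?_)
      (expect_ne_fixer_le lt hlt F q hq i j)
    exact expect_eval i fun σ => 𝔼 x, ind (F x ≠ F (single i (fixer j σ) * x))
  -- After the substitution `y = σ * x`, the modified votes see `x` only through the ranks of `j`;
  -- freezing a good `y` gives the required function.
  have h2 : 𝔼 σ : Fin n → Ranking m, 𝔼 x, ind (F x ≠ F ((fun i => fixer j (σ i)) * x)) =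
      𝔼 y : Fin n → Ranking m, 𝔼 x,
        ind (F x ≠ F (fun i => Equiv.swap (y i (ranks j x i)) j * y i)) := by
    rw [Finset.expect_comm, Finset.expect_comm (s := Finset.univ (α := Fin n → Ranking m))
      (f := fun y x => ind (F x ≠ F (fun i => Equiv.swap (y i (ranks j x i)) j * y i)))]
    refine Finset.expect_congr rfl fun x _ => ?_
    rw [← expect_mul_right x⁻¹]
    refine Finset.expect_congr rfl fun y _ => ?_
    congr 3
    ext i : 1
    simp [fixer, ranks, mul_assoc]
  rw [h2] at h1
  obtain ⟨y, -, hy⟩ := Finset.exists_le_of_expect_le Finset.univ_nonempty h1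
  exact ⟨fun r => F (fun i => Equiv.swap (y i (r i)) j * y i), hy⟩

theorem expect_ranks [NeZero m] (k : Fin m) (h : (Fin n → Fin m) → ℝ) :
    𝔼 x, h (ranks k x) = 𝔼 r, h r := by
  have h1 : ∀ r : Fin n → Fin m, 𝔼 x, h (ranks k x) = 𝔼 x, h (ranks k x + r) := fun r => by
    rw [← expect_mul_right (fun i => (Equiv.addRight (r i))⁻¹ : Fin n → Ranking m)]
    refine Finset.expect_congr rfl fun x _ => congrArg h ?_
    ext i : 1
    simp [ranks]
  have h2 : 𝔼 x, h (ranks k x) = 𝔼 r : Fin n → Fin m, 𝔼 x, h (ranks k x + r) := by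
    simp only [← h1, Fintype.expect_const]
  rw [h2, Finset.expect_comm]
  have h3 : ∀ x : Fin n → Ranking m, 𝔼 r, h (ranks k x + r) = 𝔼 r, h r := fun x =>
    expect_comp_equiv (Equiv.addLeft (ranks k x)) h
  simp only [h3, Fintype.expect_const]

/-- The ranks of `k` or of `l`, whether or not the auxiliary variable is equal to `k`. -/
def mixedRanks (k l : Fin m) (x : Fin n → Ranking m) (c : Fin n → Fin m) (i : Fin n) : Fin m :=
  if c i = k then (x i)⁻¹ k else (x i)⁻¹ l

/-- Ranks of `k` and `l` in one vote never coincide, so they are not independent. The variable `c`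
repairs this: after relabelling `l` as `c i` when `c i ≠ k`, the second entry is the rank of the
uniform alternative `c i`. -/
theorem expect_ranks_mixedRanks [NeZero m] {k l : Fin m} (hkl : k ≠ l)
    (h : (Fin n → Fin m) → (Fin n → Fin m) → ℝ) :
    𝔼 c, 𝔼 x, h (ranks k x) (mixedRanks k l x c) = 𝔼 r, 𝔼 s, h r s := by
  have h1 : ∀ c : Fin n → Fin m, 𝔼 x, h (ranks k x) (mixedRanks k l x c) =
      𝔼 y : Fin n → Ranking m, h (ranks k y) (fun i => (y i)⁻¹ (c i)) := fun c => by
    rw [← expect_mul_left (fun i => if c i = k then 1 else Equiv.swap l (c i) : Fin n → Ranking m)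
      fun y => h (ranks k y) (fun i => (y i)⁻¹ (c i))]
    refine Finset.expect_congr rfl fun x _ => ?_
    congr 1 <;> ext i : 1 <;> by_cases hc : c i = k
    · simp [ranks, hc]
    · simp [ranks, hc, Equiv.swap_apply_of_ne_of_ne hkl (Ne.symm hc)]
    · simp [mixedRanks, hc]
    · simp [mixedRanks, hc]
  simp only [h1]
  rw [Finset.expect_comm, ← expect_ranks k fun r => 𝔼 s, h r s]
  refine Finset.expect_congr rfl fun y _ => ?_
  exact expect_comp_equiv (Equiv.piCongrRight fun i => (y i)⁻¹) fun s => h (ranks k y) s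

end Votes

/-! ### Rigidity of aggregators and the final assembly -/

section Aggregators

variable {n m : ℕ} {L : Type*} {H : Subgroup (Ranking m)} {lab : Fin m → L}

theorem ranks_mul (k : Fin m) (τ x : Fin n → Ranking m) (i : Fin n) :
    ranks k (τ * x) i = (x i)⁻¹ ((τ i)⁻¹ k) := by
  simp [ranks]

/-- If the outcome is nearly always determined by a system of functions of the ranks of the
alternatives, then these functions have small defects. -/
theorem defect_le [NeZero m] (f : Aggregator n H) (g : Fin m → (Fin n → Fin m) → L) {δ : ℝ}
    (hδ : pr (fun x => ∃ o, partOf lab (f x) o ≠ g o (ranks o x)) ≤ δ) {j k l : Fin m}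
    (hjk : j ≠ k) (hjl : j ≠ l) (hkl : k ≠ l) (S : Finset (Fin n)) :
    defect (g k) S ≤ 4 * δ := by
  set bad : (Fin n → Ranking m) → Prop := fun x => ∃ o, partOf lab (f x) o ≠ g o (ranks o x)
  have hbad : ∀ τ : (Fin n → Fin m) → Fin n → Ranking m, 𝔼 c, 𝔼 x, ind (bad (τ c * x)) ≤ δ := by
    intro τ
    simp only [expect_mul_left _ fun x => ind (bad x)]
    rw [Fintype.expect_const]
    exact hδ
  -- Let `r`, `s` be the ranks of `k` and the mixed ranks. Votes with `c i = k` have `r i = s i` and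
  -- stay. In the four profiles `k` has the ranks `r`; `r` on `S` and `s` off it; `s` on `S` and `r`
  -- off it; `s`. Passing from the first to the second, or from the third to the fourth, exchanges
  -- only `j` and `k`, and `j` has the same ranks before both exchanges and the same ranks after
  -- both, so it cancels.
  set τ₁ : (Fin n → Fin m) → Fin n → Ranking m := fun c i =>
    if c i = k then 1 else if i ∈ S then 1 else Equiv.swap j l with hτ₁
  set τ₂ : (Fin n → Fin m) → Fin n → Ranking m := fun c i =>
    if c i = k then 1 else if i ∈ S then 1 else Equiv.swap k j * Equiv.swap j l with hτ₂
  set τ₃ : (Fin n → Fin m) → Fin n → Ranking m := fun c i =>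
    if c i = k then 1 else if i ∈ S then Equiv.swap k l else Equiv.swap j l with hτ₃
  set τ₄ : (Fin n → Fin m) → Fin n → Ranking m := fun c i =>
    if c i = k then 1 else if i ∈ S then Equiv.swap k l else Equiv.swap k j * Equiv.swap j l
    with hτ₄
  unfold defect
  rw [← expect_ranks_mixedRanks hkl]
  have hsum : 4 * δ = δ + δ + δ + δ := by ring
  rw [hsum]
  refine le_trans ?_ (add_le_add (add_le_add (add_le_add (hbad τ₁) (hbad τ₂)) (hbad τ₃))
    (hbad τ₄))
  simp only [← Finset.expect_add_distrib]
  refine expect_mono fun c => expect_mono fun x => ?_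
  refine (ind_mono fun hne => ?_).trans ((ind_or_le _ _).trans
    (add_le_add_left ((ind_or_le _ _).trans (add_le_add_left (ind_or_le _ _) _)) _))
  by_contra hcon
  refine hne ?_
  simp only [not_or] at hcon
  obtain ⟨⟨⟨h₁, h₂⟩, h₃⟩, h₄⟩ := hcon
  have good : ∀ {y}, ¬bad y → ∀ o, partOf lab (f y) o = g o (ranks o y) := fun {y} hy o => by
    by_contra h
    exact hy ⟨o, h⟩
  have good₁ := good h₁
  have good₂ := good h₂
  have good₃ := good h₃
  have good₄ := good h₄
  have hjk' := hjk.symm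
  have hjl' := hjl.symm
  have hkl' := hkl.symm
  have o₁₂ : ∀ o, o ≠ k → o ≠ j → ranks o (τ₁ c * x) = ranks o (τ₂ c * x) := fun o ok oj => by
    ext i : 1
    by_cases hc : c i = k <;> by_cases hi : i ∈ S <;>
      simp [ranks_mul, hτ₁, hτ₂, hc, hi, Equiv.swap_apply_of_ne_of_ne ok oj]
  have o₃₄ : ∀ o, o ≠ k → o ≠ j → ranks o (τ₃ c * x) = ranks o (τ₄ c * x) := fun o ok oj => by
    ext i : 1
    by_cases hc : c i = k <;> by_cases hi : i ∈ S <;>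
      simp [ranks_mul, hτ₃, hτ₄, hc, hi, Equiv.swap_apply_of_ne_of_ne ok oj]
  have k₁ : ranks k (τ₁ c * x) = ranks k x := by
    ext i : 1
    by_cases hc : c i = k <;> by_cases hi : i ∈ S <;>
      simp [ranks, hτ₁, hc, hi, Equiv.swap_apply_of_ne_of_ne hjk' hkl]
  have k₂ : ranks k (τ₂ c * x) = S.piecewise (ranks k x) (mixedRanks k l x c) := by
    ext i : 1
    by_cases hc : c i = k <;> by_cases hi : i ∈ S <;>
      simp [ranks, mixedRanks, hτ₂, hc, hi]
  have k₃ : ranks k (τ₃ c * x) = S.piecewise (mixedRanks k l x c) (ranks k x) := by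
    ext i : 1
    by_cases hc : c i = k <;> by_cases hi : i ∈ S <;>
      simp [ranks, mixedRanks, hτ₃, hc, hi, Equiv.swap_apply_of_ne_of_ne hjk' hkl]
  have k₄ : ranks k (τ₄ c * x) = mixedRanks k l x c := by
    ext i : 1
    by_cases hc : c i = k <;> by_cases hi : i ∈ S <;>
      simp [ranks_mul, mixedRanks, hτ₄, hc, hi]
  have j₁₃ : ranks j (τ₁ c * x) = ranks j (τ₃ c * x) := by
    ext i : 1
    by_cases hc : c i = k <;> by_cases hi : i ∈ S <;>
      simp [ranks_mul, hτ₁, hτ₃, hc, hi, Equiv.swap_apply_of_ne_of_ne hjk hjl]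
  have j₂₄ : ranks j (τ₂ c * x) = ranks j (τ₄ c * x) := by
    ext i : 1
    by_cases hc : c i = k <;> by_cases hi : i ∈ S <;>
      simp [ranks_mul, hτ₂, hτ₄, hc, hi, Equiv.swap_apply_of_ne_of_ne hjk hjl]
  have b₁₂ := balanced_partOf (lab := lab) (K := f (τ₁ c * x)) (K' := f (τ₂ c * x)) hjk'
    fun o ok oj => by rw [good₁, good₂, o₁₂ o ok oj]
  have b₃₄ := balanced_partOf (lab := lab) (K := f (τ₃ c * x)) (K' := f (τ₄ c * x)) hjk'
    fun o ok oj => by rw [good₃, good₄, o₃₄ o ok oj]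
  simp only [good₁, good₂, good₃, good₄, k₁, k₂, k₃, k₄] at b₁₂ b₃₄
  rw [j₁₃, j₂₄] at b₁₂
  intro φ
  linarith [b₁₂ φ, b₃₄ φ]

theorem expect_eq_and_eq [NeZero m] (i : Fin n) (a b : Fin m) :
    𝔼 r : Fin n → Fin m, 𝔼 s : Fin n → Fin m, ind (r i = a ∧ s i = b) = 1 / (m : ℝ) ^ 2 := by
  have h : ∀ a : Fin m, 𝔼 r : Fin n → Fin m, ind (r i = a) = 1 / (m : ℝ) := fun a => by
    rw [expect_eval i fun b => ind (b = a), Fintype.expect_eq_sum_div_card,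
      Finset.sum_eq_single a (fun b _ hb => ind_false hb) (by simp), ind_true rfl,
      Fintype.card_fin]
  simp only [ind_and, ← Finset.mul_expect, h, ← Finset.expect_mul]
  field_simp

/-- Since `a ≠ b`, the corresponding event for independent ranks can only occur when the mixed rank
is that of `l`. -/
theorem one_div_sq_le_pr [NeZero m] {k l a b : Fin m} (hkl : k ≠ l) (hab : a ≠ b) (i : Fin n) :
    1 / (m : ℝ) ^ 2 ≤ pr fun x : Fin n → Ranking m => (x i)⁻¹ k = a ∧ (x i)⁻¹ l = b := by
  rw [← expect_eq_and_eq i a b,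
    ← expect_ranks_mixedRanks hkl fun r s => ind (r i = a ∧ s i = b), Finset.expect_comm]
  refine expect_mono fun x => ?_
  refine (expect_mono fun c => ind_mono fun h => ?_).trans (le_of_eq (Fintype.expect_const _))
  refine ⟨h.1, ?_⟩
  have h2 := h.2
  unfold mixedRanks at h2
  split_ifs at h2 with hc
  · exact absurd (h.1.symm.trans h2) hab
  · exact h2

/-- An aggregator which nearly always places every alternative according to its rank in the vote of
one voter, who may depend on the alternative, is nearly constant or dictatorial. -/
theorem exists_constant_or_dictatorial [NeZero m]
    (hlab : ∀ σ : Ranking m, σ ∈ H ↔ ∀ a, lab (σ a) = lab a) (f : Aggregator n H)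
    (d : Fin m → Fin n) (h : Fin m → Fin m → L) {T : ℝ} (hT : 2 * (m : ℝ) ^ 2 * T < 1)
    (hf : pr (fun x => ∃ o, partOf lab (f x) o ≠ h o (ranks o x (d o))) ≤ T) :
    ∃ g : Aggregator n H, (IsConstant g ∨ IsDictatorial g) ∧ pr (fun x => f x ≠ g x) ≤ T := by
  set bad : (Fin n → Ranking m) → Prop := fun x => ∃ o, partOf lab (f x) o ≠ h o (ranks o x (d o))
  have good : ∀ {y}, ¬bad y → ∀ o, partOf lab (f y) o = h o (ranks o y (d o)) := fun {y} hy o => by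
    by_contra h
    exact hy ⟨o, h⟩
  have hm : (1 : ℝ) ≤ m := by exact_mod_cast NeZero.one_le
  have hT0 : 0 ≤ T := (pr_nonneg _).trans hf
  obtain ⟨x₀, hx₀⟩ : ∃ x, ¬bad x :=
    exists_not_of_pr_lt_one (hf.trans_lt (by nlinarith [one_le_pow₀ hm (n := 2)]))
  have hswap : ∀ {k l a b : Fin m}, k ≠ l → a ≠ b → (d l ≠ d k → h k a = h k b) ∧
      (d l = d k → Balanced (h k a) (h l b) (h k b) (h l a)) := by
    intro k l a b hkl hab
    -- Prescribing the ranks of `k` and `l` in one vote has probability above `2 * T`, so some such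
    -- profile is good both before and after the swap.
    set σ : Fin n → Ranking m := single (d k) (Equiv.swap k l) with hσ
    have hlt : pr (fun x => bad x ∨ bad (σ * x)) <
        pr fun x : Fin n → Ranking m => (x (d k))⁻¹ k = a ∧ (x (d k))⁻¹ l = b := by
      refine ((pr_or_le _ _).trans (add_le_add hf
        ((pr_comp_equiv (Equiv.mulLeft σ) bad).trans_le hf))).trans_lt
        (lt_of_lt_of_le ?_ (one_div_sq_le_pr hkl hab (d k)))
      rw [lt_div_iff₀ (by positivity)]
      linarith
    obtain ⟨x, ⟨hk, hl⟩, hx⟩ := exists_of_pr_lt hlt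
    rw [not_or] at hx
    have hne : ∀ o i, i ≠ d k → ranks o (σ * x) i = ranks o x i := fun o i hi => by
      simp [ranks, hσ, hi]
    have hk' : ranks k (σ * x) (d k) = b := by
      rw [ranks_mul, ← hl]; simp [hσ]
    have hl' : ranks l (σ * x) (d k) = a := by
      rw [ranks_mul, ← hk]; simp [hσ]
    have bal := balanced_partOf (lab := lab) (K := f x) (K' := f (σ * x)) hkl fun o ok ol => by
      rw [good hx.1, good hx.2]
      by_cases ho : d o = d k
      · rw [ho, ranks_mul]
        simp [ranks, hσ, Equiv.swap_apply_of_ne_of_ne ok ol]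
      · rw [hne o _ ho]
    rw [good hx.1, good hx.1, good hx.2, good hx.2, hk', show ranks k x (d k) = a from hk] at bal
    refine ⟨fun hd => ?_, fun hd => ?_⟩
    · rw [hne l _ hd] at bal
      rcases bal.eq_or with ⟨h1, -⟩ | ⟨h1, h2⟩
      · exact h1
      · exact h1.trans h2
    · rwa [hd, hl', show ranks l x (d k) = b from hl] at bal
  by_cases hconst : ∀ k a b, h k a = h k b
  · refine ⟨fun _ => f x₀, Or.inl ⟨f x₀, fun _ => rfl⟩, (pr_mono fun x hx => ?_).trans hf⟩
    by_contra hgood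
    refine hx (eq_of_partOf_eq hlab fun o => ?_)
    rw [good hgood, good hx₀]
    exact hconst o _ _
  · push Not at hconst
    obtain ⟨k, a₀, b₀, hab⟩ := hconst
    have hd : ∀ l, d l = d k := fun l => by
      by_contra hne
      have hlk : k ≠ l := fun e => hne (by rw [e])
      exact hab ((hswap hlk fun e : a₀ = b₀ => hab (by rw [e])).1 hne)
    have hh : ∀ l a, h l a = h k a := fun l a => by
      by_cases hlk : k = l
      · rw [hlk]
      obtain ⟨b, hb⟩ : ∃ b, h k a ≠ h k b := by
        by_contra! hcon
        exact hab ((hcon a₀).symm.trans (hcon b₀))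
      rcases ((hswap hlk fun e : a = b => hb (by rw [e])).2 (hd l)).eq_or with ⟨h1, -⟩ | ⟨h1, -⟩
      · exact absurd h1 hb
      · exact h1.symm
    -- The common rule is read off from the single good profile `x₀`, which gives the permutation
    -- `(x₀ (d k))⁻¹ * y₀` of the ranks.
    obtain ⟨y₀, hy₀⟩ := QuotientGroup.mk_surjective (f x₀)
    refine ⟨fun x => QuotientGroup.mk (x (d k) * ((x₀ (d k))⁻¹ * y₀)),
      Or.inr ⟨d k, _, fun _ => rfl⟩, (pr_mono fun x hx => ?_).trans hf⟩
    by_contra hgood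
    refine hx (eq_of_partOf_eq hlab fun o => ?_)
    have e := good hx₀ (x₀ (d k) ((x (d k))⁻¹ o))
    rw [← hy₀, partOf_mk hlab, hh, hd (x₀ (d k) ((x (d k))⁻¹ o))] at e
    rw [good hgood, hh, hd, partOf_mk hlab]
    simpa [ranks] using e.symm

theorem totalManipulationPower_eq (p : Preferences H) (f : Aggregator n H) :
    totalManipulationPower p f = ∑ j, ∑ i, 𝔼 x, 𝔼 y,
      ind (p.lt ((x i)⁻¹ j) j (profileIn H j (f x)) (profileIn H j (f (Function.update x i y)))) := by
  unfold totalManipulationPower manipulationPower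
  rw [Finset.sum_comm]
  rfl

theorem distance_eq (f g : Aggregator n H) : distance f g = pr fun x => f x ≠ g x := by
  unfold distance pr ind
  refine Finset.expect_congr rfl fun x _ => ?_
  congr

/-- The outcome of an aggregator of small manipulation power is nearly determined by functions of
the ranks of the single alternatives. -/
theorem exists_rank_functions (hlab : ∀ σ : Ranking m, σ ∈ H ↔ ∀ a, lab (σ a) = lab a)
    (p : Preferences H) (f : Aggregator n H) :
    ∃ g : Fin m → (Fin n → Fin m) → L,
      pr (fun x => ∃ o, partOf lab (f x) o ≠ g o (ranks o x)) ≤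
        2 * m * totalManipulationPower p f := by
  have h := fun j => exists_near_ranks (fun r => p.lt r j) (fun r => p.strictTotal r j)
    (fun x => partOf lab (f x) j) (fun x => profileIn H j (f x))
    (fun x y hxy => partOf_eq_of_profile_eq hlab (congrArg Subtype.val hxy)) j
  choose g hg using h
  refine ⟨g, (pr_exists_le _).trans ?_⟩
  rw [totalManipulationPower_eq, Finset.mul_sum]
  exact Finset.sum_le_sum fun j _ => hg j

theorem exists_near_constant_or_dictatorial (hm : 3 ≤ m) (hH : IsFixing H) (p : Preferences H)
    (f : Aggregator n H) {ε : ℝ} (hε : totalManipulationPower p f ≤ ε)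
    (hsmall : 20000000 * (m : ℝ) ^ 5 * ε < 1) (hn : 0 < n) :
    ∃ g : Aggregator n H, (IsConstant g ∨ IsDictatorial g) ∧
      pr (fun x => f x ≠ g x) ≤ 25000 * (m : ℝ) ^ 3 * ε := by
  have : NeZero m := ⟨by omega⟩
  have : Nonempty (Fin n) := ⟨⟨0, hn⟩⟩
  obtain ⟨lab, hlab⟩ := hH.exists_lab
  obtain ⟨g, hg⟩ := exists_rank_functions hlab p f
  have hm3 : (3 : ℝ) ≤ m := by exact_mod_cast hm
  replace hg := hg.trans (mul_le_mul_of_nonneg_left hε (by positivity))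
  set δ := 2 * m * ε with hδ
  have hε0 : 0 ≤ ε := by
    have : 0 ≤ 2 * m * ε := (pr_nonneg _).trans hg
    exact nonneg_of_mul_nonneg_right this (by positivity)
  have p5 : (m : ℝ) ^ 3 ≤ (m : ℝ) ^ 5 := pow_le_pow_right₀ (by linarith) (by norm_num)
  have p3 : (m : ℝ) ≤ (m : ℝ) ^ 3 := le_self_pow₀ (by linarith) (by norm_num)
  have hdef : ∀ k S, defect (g k) S ≤ 4 * δ := fun k S => by
    obtain ⟨j, hj⟩ : ∃ j, j ∉ ({k} : Finset (Fin m)) :=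
      Finset.exists_mem_notMem_of_card_lt_card (s := {k}) (t := Finset.univ) (by simp; omega) |>.imp
        fun _ h => h.2
    obtain ⟨l, hl⟩ : ∃ l, l ∉ ({k, j} : Finset (Fin m)) :=
      Finset.exists_mem_notMem_of_card_lt_card (s := {k, j}) (t := Finset.univ)
        (Finset.card_le_two.trans_lt (by simp; omega)) |>.imp fun _ h => h.2
    simp only [Finset.mem_singleton, Finset.mem_insert, not_or] at hj hl
    exact defect_le f g hg hj (Ne.symm hl.2) (Ne.symm hl.1) S
  have hdict := fun k => exists_near_eval (g k) (hdef k) (by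
    rw [Fintype.card_fin, hδ]
    nlinarith [mul_le_mul_of_nonneg_right p5 hε0])
  choose d h hh using hdict
  -- The union bound over alternatives costs `24000 * m ^ 3 * ε`, and the rank functions cost `2 * m
  -- * ε`. The requirement `2 * m ^ 2 * T < 1` is the source of the fifth power of `m`.
  refine (exists_constant_or_dictatorial hlab f d h (T := 25000 * (m : ℝ) ^ 3 * ε) ?_ ?_)
  · nlinarith [mul_nonneg (by positivity : (0 : ℝ) ≤ (m : ℝ) ^ 5) hε0]
  · have hsum : pr (fun x => ∃ k, g k (ranks k x) ≠ h k (ranks k x (d k))) ≤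
        m * (3000 * m * (4 * δ)) := by
      refine (pr_exists_le _).trans ((Finset.sum_le_card_nsmul _ _ (3000 * m * (4 * δ))
        fun k _ => ?_).trans (le_of_eq (by simp)))
      refine (le_of_eq ?_).trans ((hh k).trans (le_of_eq (by rw [Fintype.card_fin])))
      exact expect_ranks k fun r => ind (g k r ≠ h k (r (d k)))
    refine (pr_mono fun x hx => ?_).trans ((pr_or_le _ _).trans ((add_le_add hg hsum).trans ?_))
    · obtain ⟨o, ho⟩ := hx
      by_contra! hcon
      exact ho ((hcon.1 o).trans (hcon.2 o))
    · nlinarith [mul_le_mul_of_nonneg_right p3 hε0]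

end Aggregators

end SocialChoice

theorem corollary9p2 :
    ∃ (C : ℝ) (k : ℕ), ∀ (m : ℕ), 3 ≤ m →
      ∀ (H : Subgroup (SocialChoice.Ranking m)), SocialChoice.IsFixing H →
      ∀ (p : SocialChoice.Preferences H) (n : ℕ) (f : SocialChoice.Aggregator n H) (ε : ℝ),
        SocialChoice.totalManipulationPower p f ≤ ε →
        ∃ g : SocialChoice.Aggregator n H,
          (SocialChoice.IsConstant g ∨ SocialChoice.IsDictatorial g) ∧
            SocialChoice.distance f g ≤ C * (m : ℝ) ^ k * ε := by
  open SocialChoice in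
  refine ⟨20000000, 5, fun m hm H hH p n f ε hε => ?_⟩
  have hm3 : (3 : ℝ) ≤ m := by exact_mod_cast hm
  have hε0 : 0 ≤ ε := by
    refine le_trans ?_ hε
    rw [totalManipulationPower_eq]
    exact Finset.sum_nonneg fun j _ => Finset.sum_nonneg fun i _ => expect_nonneg' fun x =>
      expect_nonneg' fun y => ind_nonneg _
  simp only [distance_eq]
  by_cases hsmall : 20000000 * (m : ℝ) ^ 5 * ε < 1
  swap
  -- Here the claimed bound is at least 1, so any constant will do.
  · refine ⟨fun _ => f 1, Or.inl ⟨f 1, fun _ => rfl⟩, ?_⟩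
    refine le_trans ?_ (not_lt.1 hsmall)
    exact (expect_mono fun x => ind_le_one _).trans (le_of_eq (Fintype.expect_const _))
  -- Without voters there is a single profile and `f` is constant.
  rcases Nat.eq_zero_or_pos n with rfl | hn
  · refine ⟨fun _ => f 1, Or.inl ⟨f 1, fun _ => rfl⟩, ?_⟩
    refine (le_of_eq ?_).trans (by positivity : 0 ≤ 20000000 * (m : ℝ) ^ 5 * ε)
    exact Finset.expect_eq_zero fun x _ => ind_false (not_not.2 (congrArg f (Subsingleton.elim _ _)))
  · obtain ⟨g, hg, hd⟩ := exists_near_constant_or_dictatorial hm hH p f hε hsmall hn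
    refine ⟨g, hg, hd.trans ?_⟩
    have : (m : ℝ) ^ 3 ≤ (m : ℝ) ^ 5 := pow_le_pow_right₀ (by linarith) (by norm_num)
    linarith [mul_le_mul_of_nonneg_right this hε0,
      mul_nonneg (by positivity : (0 : ℝ) ≤ (m : ℝ) ^ 5) hε0]
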